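/- Let $P$ be a group. A crossed $P$-module $(A,\alpha)$ is a group $A$ with a left action $(p,a)\mapsto {}^{p}a$ of $P$ by group automorphisms and a group homomorphism $\alpha:A\to P$ such that $\alpha({}^{p}a)=p\,\alpha(a)\,p^{-1}$ and ${}^{\alpha(a)}b=aba^{-1}$ for all $p\in P$, $a,b\in A$. Crossed $P$-modules form a category $\mathsf{XMod}/P$, in which a morphism $(A,\alpha)\to(B,\beta)$ is a group homomorphism $f:A\to B$ with $\beta f=\alpha$ and $f({}^{p}a)={}^{p}f(a)$ for all $p\in P$, $a\in A$. A crossed $P$-module $(C,\partial)$ is free with basis $\nu:X\to C$, where $X$ is a set, if for every crossed $P$-module $(B,\beta)$ and every function $\nu':X\to B$ with $\beta\nu'=\partial\nu$ there is a unique morphism $\varphi:(C,\partial)\to(B,\beta)$ with $\varphi\nu=\nu'$; it is finitely generated free if it is free with some basis $\nu:X\to C$ with $X$ finite. Let $\Gamma$ be the full subcategory of $\mathsf{XMod}/P$ on the finitely generated free crossed $P$-modules. Theorem (The Embedding Theorem). The functor $$\mathcal U:\mathsf{XMod}/P\longrightarrow(\Gamma^{op},\mathsf{Set}),\qquad \mathcal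 U(A,\alpha)(C,\partial)=\mathrm{Hom}_{\mathsf{XMod}/P}\big((C,\partial),(A,\alpha)\big),$$ into the category of functors $\Gamma^{op}\to\mathsf{Set}$ is a full exact embedding. That is, $\mathcal U$ is full and faithful (so that $\mathcal U(A,\alpha)\cong\mathcal U(B,\beta)$ implies $(A,\alpha)\cong(B,\beta)$), and it is exact: it preserves all finite limits, and it sends regular epimorphisms (coequalisers of some parallel pair of morphisms) to regular epimorphisms. -/

import Mathlib

open CategoryTheory

universe u

/-- A crossed `P`-module `(M, ∂)`: a group `M` on which `P` acts from the left by group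
automorphisms, with a homomorphism `∂ : M → P` such that `∂ (ᵖm) = p (∂ m) p⁻¹` (CM1) and
`^(∂ m) n = m n m⁻¹` (CM2). -/
structure CrossedMod (P : Type u) [Group P] where
  carrier : Type u
  [group : Group carrier]
  [action : MulDistribMulAction P carrier]
  boundary : carrier →* P
  boundary_smul : ∀ (p : P) (m : carrier), boundary (p • m) = p * boundary m * p⁻¹
  peiffer : ∀ m n : carrier, boundary m • n = m * n * m⁻¹

namespace CrossedMod

variable {P : Type u} [Group P]

instance : CoeSort (CrossedMod P) (Type u) := ⟨carrier⟩

instance (A : CrossedMod P) : Group A := A.group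

instance (A : CrossedMod P) : MulDistribMulAction P A := A.action

/-- A morphism of crossed `P`-modules (the component on `P` is the identity): a homomorphism
that is compatible with the boundary maps and with the actions of `P`. -/
@[ext]
structure Hom (A B : CrossedMod P) where
  toMonoidHom : A →* B
  boundary_map : ∀ a : A, B.boundary (toMonoidHom a) = A.boundary a
  map_smul : ∀ (p : P) (a : A), toMonoidHom (p • a) = p • toMonoidHom a

/-- The category `XMod/P` of crossed modules over the fixed group `P`. -/
instance : Category (CrossedMod P) where
  Hom := Hom
  id A := ⟨MonoidHom.id A, fun _ => rfl, fun _ _ => rfl⟩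
  comp f g := ⟨g.toMonoidHom.comp f.toMonoidHom,
    fun a => (g.boundary_map _).trans (f.boundary_map a),
    fun p a => (congrArg g.toMonoidHom (f.map_smul p a)).trans (g.map_smul p _)⟩

/-- `A` is a free crossed `P`-module with basis `ν : X → A`: every function `ν'` from `X` to a
crossed `P`-module `B` with `∂_B ν' = ∂_A ν` extends along `ν` to a unique morphism `A ⟶ B`. -/
def IsFreeOn (A : CrossedMod P) {X : Type u} (ν : X → A) : Prop :=
  ∀ (B : CrossedMod P) (ν' : X → B), (∀ x, B.boundary (ν' x) = A.boundary (ν x)) →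
    ∃! φ : A ⟶ B, ∀ x, φ.toMonoidHom (ν x) = ν' x

variable (P) in
/-- The finitely generated free crossed `P`-modules: those that are free on some finite set. -/
def finGenFree : ObjectProperty (CrossedMod P) := fun A =>
  ∃ (X : Type u) (_ : Finite X) (ν : X → A), A.IsFreeOn ν

variable (P) in
/-- `Γ`, the full subcategory of `XMod/P` on the finitely generated free crossed `P`-modules. -/
abbrev Gam : Type (u + 1) := (finGenFree P).FullSubcategory

variable (P) in
/-- The functor `U : XMod/P ⥤ (Γᵒᵖ, Set)`, `U A C = Hom(C, A)`: the Yoneda embedding followed by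
restriction along the inclusion of `Γ`. -/
def U : CrossedMod P ⥤ (Gam P)ᵒᵖ ⥤ Type u :=
  yoneda ⋙ (Functor.whiskeringLeft _ _ _).obj (finGenFree P).ι.op

end CrossedMod

namespace CrossedMod

variable {P : Type u} [Group P]

/-! An element `a : A` with boundary `p` is the same as a morphism to `A` from the free crossed
module on one generator over `p`, so morphisms out of `Γ` see all elements, and `U` is faithful. A
natural transformation `η` thus induces a function on elements. By naturality every component of `η`
is composition with that function (`component_apply`); evaluating on free objects of rank one and
two shows it is equivariant and multiplicative, so `U` is full. Finite limits are preserved by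
Yoneda and by restriction. A regular epimorphism is surjective, by factoring through its image. Free
objects are projective for surjections, so its image under `U` is pointwise surjective, hence a
regular epimorphism of presheaves. -/

@[simp]
theorem comp_toMonoidHom_apply {A B C : CrossedMod P} (f : A ⟶ B) (g : B ⟶ C) (a : A) :
    (f ≫ g).toMonoidHom a = g.toMonoidHom (f.toMonoidHom a) :=
  rfl

theorem hom_ext {A B : CrossedMod P} {f g : A ⟶ B}
    (h : ∀ a, f.toMonoidHom a = g.toMonoidHom a) : f = g :=
  Hom.ext (MonoidHom.ext h)

/-! ### Free crossed modules -/

section Free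

variable {X : Type u}

/-- The action of an element of `P` on the free group on `P × X` by left translation of the
generators. -/
def preSMul (X : Type u) (p : P) : FreeGroup (P × X) →* FreeGroup (P × X) :=
  FreeGroup.map fun y => (p * y.1, y.2)

theorem preSMul_one (m : FreeGroup (P × X)) : preSMul X (1 : P) m = m := by
  simp [preSMul]

theorem preSMul_mul (p q : P) (m : FreeGroup (P × X)) :
    preSMul X (p * q) m = preSMul X p (preSMul X q m) := by
  simp [preSMul, FreeGroup.map.comp, Function.comp_def, mul_assoc]

/-- The boundary of the free precrossed module, which sends the generator `(p, x)` to
`p (w x) p⁻¹`. -/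
def preBoundary (w : X → P) : FreeGroup (P × X) →* P :=
  FreeGroup.lift fun y => y.1 * w y.2 * y.1⁻¹

theorem preBoundary_preSMul (w : X → P) (p : P) (m : FreeGroup (P × X)) :
    preBoundary w (preSMul X p m) = p * preBoundary w m * p⁻¹ := by
  have h : (preBoundary w).comp (preSMul X p) =
      (MulAut.conj p).toMonoidHom.comp (preBoundary w) :=
    FreeGroup.ext_hom _ _ fun y => by simp [preBoundary, preSMul, mul_assoc]
  exact DFunLike.congr_fun h m

/-- The Peiffer subgroup of the free precrossed module. -/
def peifferSubgroup (w : X → P) : Subgroup (FreeGroup (P × X)) :=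
  Subgroup.normalClosure
    {r | ∃ m n, r = preSMul X (preBoundary w m) n * (m * n * m⁻¹)⁻¹}

instance (w : X → P) : (peifferSubgroup w).Normal :=
  Subgroup.normalClosure_normal

/-- Translation by `p` takes the Peiffer relator of `(m, n)` to that of their translates, so the
action descends to the quotient. -/
theorem peifferSubgroup_le_comap_preSMul (w : X → P) (p : P) :
    peifferSubgroup w ≤ (peifferSubgroup w).comap (preSMul X p) := by
  refine Subgroup.normalClosure_le_normal ?_
  rintro _ ⟨m, n, rfl⟩
  refine Subgroup.subset_normalClosure ⟨preSMul X p m, preSMul X p n, ?_⟩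
  rw [preBoundary_preSMul, ← preSMul_mul]
  simp [preSMul_mul]

theorem peifferSubgroup_le_ker_preBoundary (w : X → P) :
    peifferSubgroup w ≤ (preBoundary w).ker := by
  refine Subgroup.normalClosure_le_normal ?_
  rintro _ ⟨m, n, rfl⟩
  simp [MonoidHom.mem_ker, preBoundary_preSMul]

instance (w : X → P) : MulDistribMulAction P (FreeGroup (P × X) ⧸ peifferSubgroup w) where
  smul p := QuotientGroup.map _ _ (preSMul X p) (peifferSubgroup_le_comap_preSMul w p)
  one_smul a := by
    induction a using QuotientGroup.induction_on with
    | H m => exact congrArg _ (preSMul_one m)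
  mul_smul p q a := by
    induction a using QuotientGroup.induction_on with
    | H m => exact congrArg _ (preSMul_mul p q m)
  smul_mul p a b := map_mul (QuotientGroup.map _ _ (preSMul X p) _) a b
  smul_one p := map_one (QuotientGroup.map _ _ (preSMul X p) _)

/-- The free crossed `P`-module on a family `w` of elements of `P`. -/
def free (w : X → P) : CrossedMod P where
  carrier := FreeGroup (P × X) ⧸ peifferSubgroup w
  boundary := QuotientGroup.lift _ (preBoundary w) (peifferSubgroup_le_ker_preBoundary w)
  boundary_smul p a := by
    induction a using QuotientGroup.induction_on with
    | H m => exact preBoundary_preSMul w p m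
  peiffer a b := by
    induction a using QuotientGroup.induction_on with
    | H m =>
      induction b using QuotientGroup.induction_on with
      | H n =>
        have h : preSMul X (preBoundary w m) n * (m * n * m⁻¹)⁻¹ ∈ peifferSubgroup w :=
          Subgroup.subset_normalClosure ⟨m, n, rfl⟩
        exact mul_inv_eq_one.mp ((QuotientGroup.eq_one_iff _).mpr h)

/-- The projection of the free group onto the free crossed module. -/
def freeMk (w : X → P) : FreeGroup (P × X) →* free w :=
  QuotientGroup.mk' (peifferSubgroup w)

theorem freeMk_surjective (w : X → P) : Function.Surjective (freeMk w) :=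
  QuotientGroup.mk'_surjective _

theorem freeMk_preSMul (w : X → P) (p : P) (m : FreeGroup (P × X)) :
    freeMk w (preSMul X p m) = p • freeMk w m :=
  rfl

theorem boundary_freeMk (w : X → P) (m : FreeGroup (P × X)) :
    (free w).boundary (freeMk w m) = preBoundary w m :=
  rfl

/-- The basis of the free crossed module. -/
def freeBasis (w : X → P) (x : X) : free w :=
  freeMk w (FreeGroup.of (1, x))

@[simp]
theorem boundary_freeBasis (w : X → P) (x : X) : (free w).boundary (freeBasis w x) = w x := by
  simp [freeBasis, boundary_freeMk, preBoundary]

theorem freeMk_of (w : X → P) (p : P) (x : X) :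
    freeMk w (FreeGroup.of (p, x)) = p • freeBasis w x := by
  rw [freeBasis, ← freeMk_preSMul]
  simp [preSMul]

section Lift

variable {w : X → P} {B : CrossedMod P} (ν : X → B)

/-- The homomorphism from the free group which extends a family of elements of `B`
equivariantly. -/
def preLift : FreeGroup (P × X) →* B :=
  FreeGroup.lift fun y => y.1 • ν y.2

theorem preLift_preSMul (p : P) (m : FreeGroup (P × X)) :
    preLift ν (preSMul X p m) = p • preLift ν m := by
  have h : (preLift ν).comp (preSMul X p) =
      (MulDistribMulAction.toMonoidHom B p).comp (preLift ν) :=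
    FreeGroup.ext_hom _ _ fun y => by simp [preLift, preSMul, mul_smul]
  exact DFunLike.congr_fun h m

variable {ν}

theorem boundary_preLift (h : ∀ x, B.boundary (ν x) = w x) (m : FreeGroup (P × X)) :
    B.boundary (preLift ν m) = preBoundary w m := by
  have h : B.boundary.comp (preLift ν) = preBoundary w :=
    FreeGroup.ext_hom _ _ fun y => by simp [preLift, preBoundary, B.boundary_smul, h]
  exact DFunLike.congr_fun h m

theorem peifferSubgroup_le_ker_preLift (h : ∀ x, B.boundary (ν x) = w x) :
    peifferSubgroup w ≤ (preLift ν).ker := by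
  refine Subgroup.normalClosure_le_normal ?_
  rintro _ ⟨m, n, rfl⟩
  rw [SetLike.mem_coe, MonoidHom.mem_ker, map_mul, preLift_preSMul, ← boundary_preLift h,
    B.peiffer]
  simp

/-- The morphism out of a free crossed module determined by its values on the basis. -/
def freeLift (ν : X → B) (h : ∀ x, B.boundary (ν x) = w x) : free w ⟶ B where
  toMonoidHom := QuotientGroup.lift _ (preLift ν) (peifferSubgroup_le_ker_preLift h)
  boundary_map a := by
    obtain ⟨m, rfl⟩ := freeMk_surjective w a
    exact boundary_preLift h m
  map_smul p a := by
    obtain ⟨m, rfl⟩ := freeMk_surjective w a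
    exact preLift_preSMul ν p m

@[simp]
theorem freeLift_freeBasis (h : ∀ x, B.boundary (ν x) = w x) (x : X) :
    (freeLift ν h).toMonoidHom (freeBasis w x) = ν x := by
  change preLift ν (FreeGroup.of (1, x)) = ν x
  simp [preLift]

theorem free_hom_ext {f g : free w ⟶ B}
    (h : ∀ x, f.toMonoidHom (freeBasis w x) = g.toMonoidHom (freeBasis w x)) : f = g := by
  have h' : f.toMonoidHom.comp (freeMk w) = g.toMonoidHom.comp (freeMk w) :=
    FreeGroup.ext_hom _ _ fun ⟨_, _⟩ => by
      simp only [MonoidHom.comp_apply, freeMk_of, f.map_smul, g.map_smul, h]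
  refine hom_ext fun a => ?_
  obtain ⟨m, rfl⟩ := freeMk_surjective w a
  exact DFunLike.congr_fun h' m

end Lift

theorem free_isFreeOn (w : X → P) : (free w).IsFreeOn (freeBasis w) := fun _ ν hν =>
  ⟨freeLift ν fun x => (hν x).trans (boundary_freeBasis w x), freeLift_freeBasis _,
    fun _ hφ => free_hom_ext fun x => (hφ x).trans (freeLift_freeBasis _ x).symm⟩

theorem finGenFree_free [Finite X] (w : X → P) : finGenFree P (free w) :=
  ⟨X, inferInstance, freeBasis w, free_isFreeOn w⟩

end Free

/-! ### Elements as morphisms out of the free crossed modules of rank one -/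

section Element

/-- The free crossed module on one generator with boundary `p`. -/
abbrev freeOne (p : P) : CrossedMod P :=
  free fun _ : PUnit.{u + 1} => p

/-- The generator of `freeOne p`. -/
abbrev freeOneGen (p : P) : freeOne p :=
  freeBasis (fun _ : PUnit.{u + 1} => p) PUnit.unit

/-- The morphism which sends the generator to a given element. -/
def ofElement {A : CrossedMod P} {p : P} (a : A) (h : A.boundary a = p) : freeOne p ⟶ A :=
  freeLift (fun _ => a) fun _ => h

@[simp]
theorem ofElement_gen {A : CrossedMod P} {p : P} (a : A) (h : A.boundary a = p) :
    (ofElement a h).toMonoidHom (freeOneGen p) = a :=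
  freeLift_freeBasis _ _

theorem ofElement_comp {A B : CrossedMod P} {p : P} (a : A) (h : A.boundary a = p) (f : A ⟶ B) :
    ofElement a h ≫ f = ofElement (f.toMonoidHom a) ((f.boundary_map a).trans h) :=
  free_hom_ext fun _ => by simp [ofElement]

end Element

/-! ### Natural transformations between the functors `U A` -/

section Full

variable {A B : CrossedMod P} (η : (U P).obj A ⟶ (U P).obj B)

/-- The component of a natural transformation at an object of `Γ`, as a map of hom-sets. -/
def component {C : CrossedMod P} (hC : finGenFree P C) (g : C ⟶ A) : C ⟶ B :=
  η.app (Opposite.op ⟨C, hC⟩) g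

theorem component_comp {C D : CrossedMod P} (hC : finGenFree P C) (hD : finGenFree P D)
    (k : D ⟶ C) (g : C ⟶ A) : component η hD (k ≫ g) = k ≫ component η hC g :=
  NatTrans.naturality_apply η
    (ObjectProperty.homMk k : (⟨D, hD⟩ : Gam P) ⟶ ⟨C, hC⟩).op g

/-- The value at an element of the map induced by a natural transformation. -/
def inducedFun (a : A) : B :=
  (component η (finGenFree_free _) (ofElement a rfl)).toMonoidHom (freeOneGen (A.boundary a))

/-- Leaving `p` free lets `inducedFun` be tested on a generator whose boundary equals that of `a`
only propositionally. -/
theorem component_ofElement {p : P} (a : A) (h : A.boundary a = p) :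
    (component η (finGenFree_free _) (ofElement a h)).toMonoidHom (freeOneGen p) =
      inducedFun η a := by
  subst h
  rfl

/-- Naturality along the morphism `freeOne _ ⟶ C` that picks out `c`. -/
theorem component_apply {C : CrossedMod P} (hC : finGenFree P C) (g : C ⟶ A) (c : C) :
    (component η hC g).toMonoidHom c = inducedFun η (g.toMonoidHom c) := by
  rw [← component_ofElement η (g.toMonoidHom c) (g.boundary_map c), ← ofElement_comp c rfl g,
    component_comp η hC, comp_toMonoidHom_apply, ofElement_gen]

theorem boundary_inducedFun (a : A) : B.boundary (inducedFun η a) = A.boundary a :=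
  (Hom.boundary_map _ _).trans (boundary_freeBasis _ _)

theorem inducedFun_smul (p : P) (a : A) : inducedFun η (p • a) = p • inducedFun η a := by
  -- The component is itself equivariant, so its value here can be computed in two ways.
  have h := component_apply η (finGenFree_free _) (ofElement a rfl) (p • freeOneGen _)
  rw [Hom.map_smul, Hom.map_smul, component_apply, ofElement_gen] at h
  exact h.symm

theorem inducedFun_mul (a b : A) :
    inducedFun η (a * b) = inducedFun η a * inducedFun η b := by
  -- Two free generators mapping to `a` and `b`; a component is a homomorphism, so it respects their
  -- product.
  let ν : ULift.{u} Bool → A := fun i => cond i.down a b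
  have h := component_apply η (finGenFree_free fun i => A.boundary (ν i))
    (freeLift ν fun _ => rfl) (freeBasis _ ⟨true⟩ * freeBasis _ ⟨false⟩)
  rw [map_mul, map_mul, component_apply, component_apply, freeLift_freeBasis,
    freeLift_freeBasis] at h
  exact h.symm

/-- The morphism of crossed modules induced by a natural transformation. -/
def inducedHom : A ⟶ B where
  toMonoidHom := MonoidHom.mk' (inducedFun η) (inducedFun_mul η)
  boundary_map := boundary_inducedFun η
  map_smul := inducedFun_smul η

theorem U_map_inducedHom : (U P).map (inducedHom η) = η := by
  ext C g
  exact hom_ext fun c => (component_apply η C.unop.property g c).symm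

end Full

instance : (U P).Full where
  map_surjective η := ⟨inducedHom η, U_map_inducedHom η⟩

instance : (U P).Faithful where
  map_injective {A B f g} h := by
    refine hom_ext fun a => ?_
    have h₁ : ofElement a rfl ≫ f = ofElement a rfl ≫ g :=
      ConcreteCategory.congr_hom (NatTrans.congr_app h
        (Opposite.op ⟨freeOne (A.boundary a), finGenFree_free _⟩)) (ofElement a rfl)
    simpa using congrArg (fun k => Hom.toMonoidHom k (freeOneGen _)) h₁

/-! ### Exactness -/

instance : Limits.PreservesFiniteLimits (U P) where
  preservesFiniteLimits J _ _ := by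
    unfold U
    -- Limits of presheaves are pointwise, so restriction to `Γ` preserves them.
    infer_instance

section Image

variable {A B : CrossedMod P} (f : A ⟶ B)

theorem smul_mem_range (p : P) (b : f.toMonoidHom.range) :
    p • (b : B) ∈ f.toMonoidHom.range := by
  obtain ⟨_, a, rfl⟩ := b
  exact ⟨p • a, f.map_smul p a⟩

instance : MulDistribMulAction P f.toMonoidHom.range where
  smul p b := ⟨p • (b : B), smul_mem_range f p b⟩
  one_smul b := Subtype.ext (one_smul P (b : B))
  mul_smul p q b := Subtype.ext (mul_smul p q (b : B))
  smul_mul p b c := Subtype.ext (smul_mul' p (b : B) (c : B))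
  smul_one p := Subtype.ext (smul_one p)

/-- The image of a morphism of crossed modules. -/
def image : CrossedMod P where
  carrier := f.toMonoidHom.range
  boundary := B.boundary.comp f.toMonoidHom.range.subtype
  boundary_smul p b := B.boundary_smul p b
  peiffer b c := Subtype.ext (B.peiffer b c)

/-- The inclusion of the image. -/
def imageι : image f ⟶ B where
  toMonoidHom := f.toMonoidHom.range.subtype
  boundary_map _ := rfl
  map_smul _ _ := rfl

/-- The corestriction of a morphism to its image. -/
def toImage : A ⟶ image f where
  toMonoidHom := f.toMonoidHom.rangeRestrict
  boundary_map a := f.boundary_map a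
  map_smul p a := Subtype.ext (f.map_smul p a)

theorem toImage_comp_imageι : toImage f ≫ imageι f = f :=
  rfl

instance : Mono (imageι f) where
  right_cancellation _ _ e :=
    hom_ext fun c => Subtype.ext (DFunLike.congr_fun (congrArg Hom.toMonoidHom e) c)

end Image

/-- The image inclusion is a mono and, as last factor of a strong epi, a strong epi; hence it is an
isomorphism. -/
theorem surjective_of_strongEpi {A B : CrossedMod P} (f : A ⟶ B) [StrongEpi f] :
    Function.Surjective f.toMonoidHom := by
  have : StrongEpi (toImage f ≫ imageι f) := by rwa [toImage_comp_imageι]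
  have : StrongEpi (imageι f) := strongEpi_of_strongEpi (toImage f) (imageι f)
  have : IsIso (imageι f) := isIso_of_mono_of_strongEpi _
  intro b
  obtain ⟨a, ha⟩ := ((inv (imageι f)).toMonoidHom b).2
  refine ⟨a, ha.trans ?_⟩
  exact DFunLike.congr_fun (congrArg Hom.toMonoidHom (IsIso.inv_hom_id (imageι f))) b

/-- Free crossed modules are projective with respect to surjective morphisms. -/
theorem IsFreeOn.exists_lift {C A B : CrossedMod P} {X : Type u} {ν : X → C} (hC : C.IsFreeOn ν)
    {f : A ⟶ B} (hf : Function.Surjective f.toMonoidHom) (g : C ⟶ B) :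
    ∃ k : C ⟶ A, k ≫ f = g := by
  choose s hs using hf
  -- A set-theoretic section suffices: `f` preserves boundaries, so the chosen preimages have the
  -- required ones.
  obtain ⟨k, hk, -⟩ := hC A (fun x => s (g.toMonoidHom (ν x))) fun x => by
    rw [← f.boundary_map, hs, g.boundary_map]
  refine ⟨k, (hC B _ fun x => g.boundary_map (ν x)).unique (fun x => ?_) fun _ => rfl⟩
  simp [hk, hs]

theorem epi_U_map {A B : CrossedMod P} {f : A ⟶ B} (hf : Function.Surjective f.toMonoidHom) :
    Epi ((U P).map f) := by
  refine (NatTrans.epi_iff_epi_app _).mpr fun C => (epi_iff_surjective _).mpr fun g => ?_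
  obtain ⟨X, -, ν, hν⟩ := C.unop.property
  exact hν.exists_lift hf g

end CrossedMod

/-- `U` is a full exact embedding: full, faithful (hence injective on isomorphism classes of
objects, which is stated too), and it preserves finite limits and regular epimorphisms. -/
theorem mainTheorem2 (P : Type u) [Group P] :
    (CrossedMod.U P).Full ∧ (CrossedMod.U P).Faithful ∧
    (∀ A B : CrossedMod P,
      Nonempty ((CrossedMod.U P).obj A ≅ (CrossedMod.U P).obj B) → Nonempty (A ≅ B)) ∧
    Limits.PreservesFiniteLimits (CrossedMod.U P) ∧
    (∀ {A B : CrossedMod P} (f : A ⟶ B), IsRegularEpi f →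
      IsRegularEpi ((CrossedMod.U P).map f)) := by
  refine ⟨inferInstance, inferInstance, fun A B ⟨e⟩ => ⟨(CrossedMod.U P).preimageIso e⟩,
    inferInstance, fun f hf => ?_⟩
  have := CrossedMod.epi_U_map (CrossedMod.surjective_of_strongEpi f)
  -- In a category of presheaves of sets every epimorphism is regular.
  exact IsRegularEpiCategory.regularEpiOfEpi _
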